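/- Let $\mathbb S$ be a Polish space whose topology is given by a fixed metric, let $\mathcal S$ be its Borel $\sigma$-field and $\mathcal S_b$ the ring of Borel sets that are bounded in this metric. Let $\mathcal I\subset\mathcal S_b$ be a countable semi-ring that generates $\mathcal S$ and is topological and dissecting: every open set is a countable union of sets in $\mathcal I$, and every set in $\mathcal S_b$ is covered by finitely many sets in $\mathcal I$. Let $\mathbf M(\mathbb S)$ be the space of measures on $(\mathbb S,\mathcal S)$ that are finite on $\mathcal S_b$, with the smallest $\sigma$-field making the maps $\mu\mapsto\mu(B)$, $B\in\mathcal S$, measurable, and let $M$ be a random measure on $\mathbb S$, i.e. a measurable map from a probability space into $\mathbf M(\mathbb S)$. A random vector $X=(X_1,\dots,X_n)$ in $\mathbb R^n$ is negatively associated if $\mathbb E[f(X_J)g(X_{J^c})]\le \mathbb E[f(X_J)]\,\mathbb E[g(X_{J^c})]$ for all $J\subset\{1,\dots,n\}$ and all coordinatewise non-decreasing bounded measurable $f\colon\mathbb R^J\to\mathbb R$, $g\colon\mathbb R^{J^c}\to\mathbb R$, where $X_J=(X_i)_{i\in J}$. It is positively associated if $\mathbb E[f(X_J)g(X_J)]\ge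 \mathbb E[f(X_J)]\,\mathbb E[g(X_J)]$ for all $J\subset\{1,\dots,n\}$ and all coordinatewise non-decreasing bounded measurable $f,g\colon\mathbb R^J\to\mathbb R$. Then: (i) $(M(B_1),\dots,M(B_n))$ is negatively associated for all $n\ge1$ and all pairwise disjoint $B_1,\dots,B_n\in\mathcal I$ if and only if $(M(B_1),\dots,M(B_n))$ is negatively associated for all $n\ge1$ and all pairwise disjoint $B_1,\dots,B_n\in\mathcal S_b$; (ii) $(M(B_1),\dots,M(B_n))$ is positively associated for all $n\ge1$ and all pairwise disjoint $B_1,\dots,B_n\in\mathcal I$ if and only if $(M(B_1),\dots,M(B_n))$ is positively associated for all $n\ge1$ and all pairwise disjoint $B_1,\dots,B_n\in\mathcal S_b$. -/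

import Mathlib

open MeasureTheory

/-- The family `X = (X_i)` of random elements of a partially ordered space `E` is negatively
associated: `E[f(X_J) g(X_{Jᶜ})] ≤ E[f(X_J)] E[g(X_{Jᶜ})]` for every set `J` of indices and all
coordinatewise non-decreasing bounded measurable `f`, `g`. -/
def NegativelyAssociated {Ω ι E : Type*} [MeasurableSpace Ω] [PartialOrder E] [MeasurableSpace E]
    (P : Measure Ω) (X : ι → Ω → E) : Prop :=
  ∀ (J : Set ι) (f : (↥J → E) → ℝ) (g : (↥(Jᶜ) → E) → ℝ),
    Monotone f → Measurable f → (∃ C : ℝ, ∀ x, |f x| ≤ C) →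
    Monotone g → Measurable g → (∃ C : ℝ, ∀ x, |g x| ≤ C) →
    ∫ ω, f (fun i => X i ω) * g (fun i => X i ω) ∂P ≤
      (∫ ω, f (fun i => X i ω) ∂P) * ∫ ω, g (fun i => X i ω) ∂P

/-- The family `X = (X_i)` of random elements of a partially ordered space `E` is positively
associated: `E[f(X_J) g(X_J)] ≥ E[f(X_J)] E[g(X_J)]` for every set `J` of indices and all
coordinatewise non-decreasing bounded measurable `f`, `g`. -/
def PositivelyAssociated {Ω ι E : Type*} [MeasurableSpace Ω] [PartialOrder E] [MeasurableSpace E]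
    (P : Measure Ω) (X : ι → Ω → E) : Prop :=
  ∀ (J : Set ι) (f g : (↥J → E) → ℝ),
    Monotone f → Measurable f → (∃ C : ℝ, ∀ x, |f x| ≤ C) →
    Monotone g → Measurable g → (∃ C : ℝ, ∀ x, |g x| ≤ C) →
    (∫ ω, f (fun i => X i ω) ∂P) * ∫ ω, g (fun i => X i ω) ∂P ≤
      ∫ ω, f (fun i => X i ω) * g (fun i => X i ω) ∂P

/-- The ring of bounded Borel sets of a metric space. -/
def boundedBorelSets (S : Type*) [MetricSpace S] [MeasurableSpace S] : Set (Set S) :=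
  {B | Bornology.IsBounded B ∧ MeasurableSet B}

/-- The space of locally finite measures: those which are finite on bounded Borel sets. -/
def LocallyFiniteMeasure (S : Type*) [MetricSpace S] [MeasurableSpace S] : Type _ :=
  {μ : Measure S // ∀ B ∈ boundedBorelSets S, μ B < ⊤}

/-- The smallest `σ`-field on the space of locally finite measures that makes the evaluations
`μ ↦ μ B`, for `B` Borel, measurable. -/
instance LocallyFiniteMeasure.instMeasurableSpace (S : Type*) [MetricSpace S]
    [MeasurableSpace S] : MeasurableSpace (LocallyFiniteMeasure S) :=
  ⨆ (B : Set S) (_ : MeasurableSet B),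
    (inferInstance : MeasurableSpace ENNReal).comap
      (fun μ : LocallyFiniteMeasure S => μ.1 B)

/-- Countable, topological, dissecting semi-rings of bounded Borel sets generating the Borel
`σ`-field. -/
structure IsDissectingSemiring {S : Type*} [MetricSpace S] [MeasurableSpace S]
    (I : Set (Set S)) : Prop where
  subset_boundedBorelSets : I ⊆ boundedBorelSets S
  countable : I.Countable
  isSetSemiring : IsSetSemiring I
  generateFrom_eq : MeasurableSpace.generateFrom I = borel S
  /-- Every open set is a countable union of sets of the semi-ring. -/
  isOpen_eq_sUnion : ∀ G : Set S, IsOpen G → ∃ T ⊆ I, T.Countable ∧ G = ⋃₀ T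
  /-- Every bounded Borel set is covered by finitely many sets of the semi-ring. -/
  exists_finite_cover : ∀ B ∈ boundedBorelSets S, ∃ T ⊆ I, T.Finite ∧ B ⊆ ⋃₀ T

/-- The random vector `(M(B_1), …, M(B_n))`, as a family of real random variables (for bounded
Borel sets `B_i` the values `M(B_i)` are finite). -/
noncomputable def evalVector {Ω S : Type*} [MetricSpace S] [MeasurableSpace S]
    (M : Ω → LocallyFiniteMeasure S) {n : ℕ} (B : Fin n → Set S) : Fin n → Ω → ℝ :=
  fun i ω => ((M ω).1 (B i)).toReal

open Filter Topology
open scoped symmDiff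

/-! Since `I` consists of bounded Borel sets, only the passage from `I` to all bounded Borel sets
needs an argument. It goes through the ring `supClosure I` of finite disjoint unions.

On the ring, values of `M` are sums of values on disjoint sets of `I`. Sums over disjoint blocks are
non-decreasing in the coordinates, so association survives (`sum_fiber`).

Bounded Borel sets are almost sure limits of ring sets
(`IsDissectingSemiring.exists_tendsto_evalVector`). Approximating in the single finite measure E[M(·
∩ K) / (1 + M(K))] with summable errors gives almost sure convergence, without any moment assumption
on `M`.

Association passes to almost sure limits (`of_tendsto`). This is dominated convergence for
continuous test functions; the measurable monotone ones are reduced to these by L¹ approximation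
under the law of the limit (`Monotone.monotoneApproximable`). -/

/-- `f` can be approximated in `L¹(μ)` by continuous bounded non-decreasing functions. -/
def MonotoneApproximable {X : Type*} [TopologicalSpace X] [Preorder X] [MeasurableSpace X]
    (μ : Measure X) (f : X → ℝ) : Prop :=
  ∀ ε : ℝ, 0 < ε → ∃ h : X → ℝ, Continuous h ∧ Monotone h ∧ (∃ C : ℝ, ∀ x, |h x| ≤ C) ∧
    ∫ x, |f x - h x| ∂μ ≤ ε

lemma Measurable.integrable_of_abs_le {X : Type*} [MeasurableSpace X] {μ : Measure X}
    [IsFiniteMeasure μ] {f : X → ℝ} (hf : Measurable f) (hb : ∃ C : ℝ, ∀ x, |f x| ≤ C) :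
    Integrable f μ :=
  hb.elim fun C hC => .of_bound hf.aestronglyMeasurable C (.of_forall hC)

/-! ### Closure properties of monotone L¹ approximation. -/

namespace MonotoneApproximable

section Operations

variable {X : Type*} [TopologicalSpace X] [Preorder X] [MeasurableSpace X]
  {μ : Measure X} {f g : X → ℝ}

lemma const (c : ℝ) : MonotoneApproximable μ fun _ => c := fun ε hε =>
  ⟨fun _ => c, continuous_const, monotone_const, ⟨|c|, fun _ => le_rfl⟩, by simpa using hε.le⟩

lemma const_mul {c : ℝ} (hc : 0 < c) (hf : MonotoneApproximable μ f) :
    MonotoneApproximable μ fun x => c * f x := by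
  intro ε hε
  obtain ⟨h, hh, hm, ⟨C, hC⟩, hfh⟩ := hf (ε / c) (div_pos hε hc)
  refine ⟨fun x => c * h x, by fun_prop, hm.const_mul hc.le, ⟨c * C, fun x => ?_⟩, ?_⟩
  · rw [abs_mul, abs_of_pos hc]
    exact mul_le_mul_of_nonneg_left (hC x) hc.le
  · simp_rw [← mul_sub, abs_mul, abs_of_pos hc]
    rw [integral_const_mul]
    exact (mul_le_mul_of_nonneg_left hfh hc.le).trans_eq (mul_div_cancel₀ _ hc.ne')

variable [BorelSpace X] [IsFiniteMeasure μ]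

/-- The `L¹` closure property. -/
lemma of_forall_exists (hf : Integrable f μ)
    (H : ∀ ε : ℝ, 0 < ε → ∃ g : X → ℝ, Integrable g μ ∧ MonotoneApproximable μ g ∧
      ∫ x, |f x - g x| ∂μ ≤ ε) : MonotoneApproximable μ f := by
  intro ε hε
  obtain ⟨g, hgi, hg, hfg⟩ := H (ε / 2) (half_pos hε)
  obtain ⟨h, hc, hm, hb, hgh⟩ := hg (ε / 2) (half_pos hε)
  have hi : Integrable h μ := hc.measurable.integrable_of_abs_le hb
  refine ⟨h, hc, hm, hb, ?_⟩
  calc ∫ x, |f x - h x| ∂μ ≤ ∫ x, (|f x - g x| + |g x - h x|) ∂μ :=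
        integral_mono (hf.sub hi).abs ((hf.sub hgi).abs.add (hgi.sub hi).abs)
          fun x => abs_sub_le _ _ _
    _ = ∫ x, |f x - g x| ∂μ + ∫ x, |g x - h x| ∂μ :=
        integral_add (hf.sub hgi).abs (hgi.sub hi).abs
    _ ≤ ε := by linarith

lemma add (hfi : Integrable f μ) (hgi : Integrable g μ) (hf : MonotoneApproximable μ f)
    (hg : MonotoneApproximable μ g) : MonotoneApproximable μ fun x => f x + g x := by
  intro ε hε
  obtain ⟨h, hc, hm, ⟨C, hC⟩, hfh⟩ := hf (ε / 2) (half_pos hε)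
  obtain ⟨k, kc, km, ⟨D, hD⟩, hgk⟩ := hg (ε / 2) (half_pos hε)
  have hhi : Integrable h μ := hc.measurable.integrable_of_abs_le ⟨C, hC⟩
  have hki : Integrable k μ := kc.measurable.integrable_of_abs_le ⟨D, hD⟩
  refine ⟨fun x => h x + k x, hc.add kc, hm.add km,
    ⟨C + D, fun x => (abs_add_le _ _).trans (add_le_add (hC x) (hD x))⟩, ?_⟩
  calc ∫ x, |f x + g x - (h x + k x)| ∂μ ≤ ∫ x, (|f x - h x| + |g x - k x|) ∂μ := by
        refine integral_mono ((hfi.add hgi).sub (hhi.add hki)).abs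
          ((hfi.sub hhi).abs.add (hgi.sub hki).abs) fun x => ?_
        simpa only [add_sub_add_comm] using abs_add_le (f x - h x) (g x - k x)
    _ = ∫ x, |f x - h x| ∂μ + ∫ x, |g x - k x| ∂μ :=
        integral_add (hfi.sub hhi).abs (hgi.sub hki).abs
    _ ≤ ε := by linarith

lemma sum {κ : Type*} (s : Finset κ) {F : κ → X → ℝ} (hFi : ∀ j, Integrable (F j) μ)
    (hF : ∀ j, MonotoneApproximable μ (F j)) :
    MonotoneApproximable μ fun x => ∑ j ∈ s, F j x := by
  classical
  induction s using Finset.induction_on with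
  | empty => simpa using const 0
  | insert j s hj ih =>
    simp_rw [Finset.sum_insert hj]
    exact add (hFi j) (integrable_finsetSum _ fun j _ => hFi j) (hF j) ih

end Operations

end MonotoneApproximable

/-! ### Approximating monotone functions through indicators of upper sets. -/

section Upper

variable {ι : Type*} [Fintype ι]

/-- Translating `z ∈ F` by `y - x ≥ 0` keeps it in `F` and puts it as far from `y` as `z` is from
`x`. -/
lemma IsUpperSet.infEDist_antitone {F : Set (ι → ℝ)} (hF : IsUpperSet F) :
    Antitone fun x => Metric.infEDist x F := by
  intro x y hxy
  refine Metric.le_infEDist.2 fun z hz => ?_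
  have hmem : y + (z - x) ∈ F := hF (show z ≤ y + (z - x) by
    rw [← add_sub_assoc, add_comm, add_sub_assoc]
    exact le_add_of_nonneg_right (sub_nonneg.2 hxy)) hz
  refine (Metric.infEDist_le_edist_of_mem hmem).trans_eq ?_
  rw [edist_eq_enorm_sub, edist_eq_enorm_sub, sub_add_cancel_left, neg_sub]

lemma IsUpperSet.thickenedIndicator_monotone {F : Set (ι → ℝ)} (hF : IsUpperSet F) {δ : ℝ}
    (hδ : 0 < δ) : Monotone fun x => (thickenedIndicator hδ F x : ℝ) := by
  intro x y hxy
  refine NNReal.coe_le_coe.2 (ENNReal.toNNReal_mono thickenedIndicatorAux_lt_top.ne ?_)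
  exact thickenedIndicatorAux_mono_infEDist δ (hF.infEDist_antitone hxy)

variable {μ : Measure (ι → ℝ)} [IsFiniteMeasure μ]

lemma MonotoneApproximable.indicator_of_isClosed {F : Set (ι → ℝ)} (hF : IsUpperSet F)
    (hFc : IsClosed F) : MonotoneApproximable μ (F.indicator fun _ => (1 : ℝ)) := by
  intro ε hε
  have key := tendsto_integral_thickenedIndicator_of_isClosed μ hFc
    (δs := fun n : ℕ => (1 : ℝ) / (n + 1)) (fun n => Nat.one_div_pos_of_nat)
    tendsto_one_div_add_atTop_nhds_zero_nat
  obtain ⟨n, hn⟩ := (key.eventually (ge_mem_nhds (lt_add_of_pos_right _ hε))).exists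
  have hδ : (0 : ℝ) < 1 / ((n : ℝ) + 1) := Nat.one_div_pos_of_nat
  set h : (ι → ℝ) → ℝ := fun x => (thickenedIndicator hδ F x : ℝ) with hh
  have hc : Continuous h := NNReal.continuous_coe.comp (thickenedIndicator hδ F).continuous
  have hb : ∃ C : ℝ, ∀ x, |h x| ≤ C := ⟨1, fun x => by
    rw [abs_of_nonneg (NNReal.coe_nonneg _)]
    exact_mod_cast thickenedIndicator_le_one hδ F x⟩
  have hi : Integrable h μ := hc.measurable.integrable_of_abs_le hb
  have hFi : Integrable (F.indicator fun _ => (1 : ℝ)) μ :=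
    (integrable_const _).indicator hFc.measurableSet
  refine ⟨h, hc, hF.thickenedIndicator_monotone hδ, hb, ?_⟩
  -- The thickened indicator dominates the indicator, so the L¹ distance is a difference of
  -- integrals.
  have hle : ∀ x, |F.indicator (fun _ => (1 : ℝ)) x - h x| =
      h x - F.indicator (fun _ => (1 : ℝ)) x := by
    intro x
    rw [abs_sub_comm, abs_of_nonneg]
    by_cases hx : x ∈ F
    · rw [Set.indicator_of_mem hx]
      simp only [hh, thickenedIndicator_one hδ F hx, NNReal.coe_one, sub_self, le_refl]
    · simp [hh, hx]
  simp_rw [hle]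
  rw [integral_sub hi hFi, integral_indicator_const _ hFc.measurableSet]
  simp only [smul_eq_mul, mul_one]
  have : ∫ x, h x ∂μ ≤ μ.real F + ε := hn
  linarith

/-- Inner regularity gives a compact `K ⊆ U` of almost full measure. Its upper closure stays inside
the upper set `U`, and is closed because `K` is closed and bounded below. -/
lemma MonotoneApproximable.indicator {U : Set (ι → ℝ)} (hU : IsUpperSet U)
    (hUm : MeasurableSet U) : MonotoneApproximable μ (U.indicator fun _ => (1 : ℝ)) := by
  refine .of_forall_exists ((integrable_const _).indicator hUm) fun ε hε => ?_
  obtain ⟨K, hKU, hK, hlt⟩ := hUm.exists_isCompact_sdiff_lt (μ := μ) (measure_ne_top _ _)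
    (ENNReal.ofReal_pos.2 hε).ne'
  set F : Set (ι → ℝ) := ((upperClosure K : UpperSet (ι → ℝ)) : Set (ι → ℝ))
  have hFc : IsClosed F := hK.isClosed.upperClosure_pi hK.isBounded.bddBelow
  have hFU : F ⊆ U := fun x ⟨y, hy, hyx⟩ => hU hyx (hKU hy)
  have hd : MeasurableSet (U \ F) := hUm.diff hFc.measurableSet
  refine ⟨F.indicator fun _ => 1, (integrable_const _).indicator hFc.measurableSet,
    .indicator_of_isClosed (upperClosure K).upper hFc, ?_⟩
  have heq : ∀ x, |U.indicator (fun _ => (1 : ℝ)) x - F.indicator (fun _ => 1) x| =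
      (U \ F).indicator (fun _ => (1 : ℝ)) x := by
    intro x
    by_cases hx : x ∈ F
    · simp [hx, hFU hx]
    · by_cases hx' : x ∈ U <;> simp [hx, hx']
  simp_rw [heq]
  rw [integral_indicator_const _ hd, smul_eq_mul, mul_one]
  refine ENNReal.toReal_le_of_le_ofReal hε.le (le_trans (measure_mono ?_) hlt.le)
  exact Set.sdiff_subset_sdiff_right (subset_upperClosure)

lemma sum_range_ite_le_eq_floor {m : ℕ} {t : ℝ} (ht0 : 0 ≤ t) (ht : t ≤ m) :
    ∑ j ∈ Finset.range m, (if ((j : ℝ) + 1) ≤ t then (1 : ℝ) else 0) = ⌊t⌋₊ := by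
  rw [Finset.sum_boole]
  have : (Finset.range m).filter (fun j : ℕ => ((j : ℝ) + 1) ≤ t) = Finset.range ⌊t⌋₊ := by
    ext j
    have h1 : ((j : ℝ) + 1) ≤ t ↔ j < ⌊t⌋₊ := by
      rw [← Nat.succ_le_iff, Nat.le_floor_iff ht0]
      push_cast
      rfl
    have h2 : ⌊t⌋₊ ≤ m := Nat.floor_le_of_le ht
    simp only [Finset.mem_filter, Finset.mem_range, h1]
    omega
  rw [this, Finset.card_range]

/-- A bounded measurable coordinatewise non-decreasing function is an `L¹`-limit of continuous
bounded non-decreasing functions. -/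
theorem Monotone.monotoneApproximable {f : (ι → ℝ) → ℝ} (hf : Monotone f) (hfm : Measurable f)
    (hb : ∃ C : ℝ, ∀ x, |f x| ≤ C) : MonotoneApproximable μ f := by
  have hfi : Integrable f μ := hfm.integrable_of_abs_le hb
  obtain ⟨C, hC⟩ := hb
  refine .of_forall_exists hfi fun ε hε => ?_
  obtain ⟨δ, hδ, hδε⟩ : ∃ δ : ℝ, 0 < δ ∧ δ * μ.real Set.univ ≤ ε := by
    have h0 : 0 ≤ μ.real Set.univ := measureReal_nonneg
    refine ⟨ε / (μ.real Set.univ + 1), by positivity, ?_⟩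
    rw [div_mul_eq_mul_div, div_le_iff₀ (by positivity)]
    nlinarith
  obtain ⟨m, hm⟩ := exists_nat_ge (2 * C / δ)
  -- Layer cake with mesh `δ`: the number of superlevel sets `U j` containing `x` is the floor of
  -- `(f x + C) / δ`, and `m` levels suffice because this quotient is at most `2 * C / δ`.
  set U : ℕ → Set (ι → ℝ) := fun j => {x | (j : ℝ) + 1 ≤ (f x + C) / δ} with hU
  have hUm : ∀ j, MeasurableSet (U j) := fun j =>
    measurableSet_le measurable_const ((hfm.add_const C).div_const δ)
  have hUu : ∀ j, IsUpperSet (U j) := fun j x y hxy hx => by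
    refine le_trans (show (j : ℝ) + 1 ≤ (f x + C) / δ from hx) ?_
    gcongr
    exact hf hxy
  have hUi : ∀ j, Integrable ((U j).indicator fun _ => (1 : ℝ)) μ := fun j =>
    (integrable_const _).indicator (hUm j)
  have hSi : Integrable (fun x => ∑ j ∈ Finset.range m, (U j).indicator (fun _ => (1 : ℝ)) x) μ :=
    integrable_finsetSum _ fun j _ => hUi j
  have hgi : Integrable (fun x =>
      δ * ∑ j ∈ Finset.range m, (U j).indicator (fun _ => (1 : ℝ)) x + -C) μ :=
    (hSi.const_mul δ).add (integrable_const _)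
  refine ⟨_, hgi, .add (hSi.const_mul δ) (integrable_const _)
    (.const_mul hδ (.sum _ hUi fun j => .indicator (hUu j) (hUm j))) (.const _), ?_⟩
  have hpt : ∀ x, |f x - (δ * ∑ j ∈ Finset.range m, (U j).indicator (fun _ => (1 : ℝ)) x + -C)|
      ≤ δ := by
    intro x
    have h0 := abs_le.1 (hC x)
    have ht0 : 0 ≤ (f x + C) / δ := div_nonneg (by linarith) hδ.le
    have ht : (f x + C) / δ ≤ m := le_trans (by gcongr; linarith) hm
    have hs : ∑ j ∈ Finset.range m, (U j).indicator (fun _ => (1 : ℝ)) x =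
        ⌊(f x + C) / δ⌋₊ := by
      rw [← sum_range_ite_le_eq_floor ht0 ht]
      simp only [hU, Set.indicator_apply, Set.mem_ofPred_eq]
    rw [hs]
    have h1 := Nat.floor_le ht0
    have h2 := Nat.lt_floor_add_one ((f x + C) / δ)
    have h3 : f x + C = δ * ((f x + C) / δ) := by field_simp
    rw [abs_le]
    constructor <;> nlinarith
  calc _ ≤ ∫ _, δ ∂μ := integral_mono (hfi.sub hgi).abs (integrable_const _) hpt
    _ ≤ ε := by simpa [mul_comm] using hδε

end Upper

/-! ### Stability of association under almost sure convergence. -/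

section Limits

variable {Ω : Type*} [MeasurableSpace Ω] {P : Measure Ω}

/-- Splitting `ab - a'b' = a(b - b') + b'(a - a')` requires bounds on `a` and `b'` only. -/
lemma abs_integral_mul_sub_integral_mul_le {a b a' b' : Ω → ℝ} {C D : ℝ} (hC : ∀ ω, |a ω| ≤ C)
    (hD : ∀ ω, |b' ω| ≤ D) (hab : Integrable (fun ω => a ω * b ω) P)
    (hab' : Integrable (fun ω => a' ω * b' ω) P) (ha : Integrable a P) (ha' : Integrable a' P)
    (hb : Integrable b P) (hb' : Integrable b' P) :
    |∫ ω, a ω * b ω ∂P - ∫ ω, a' ω * b' ω ∂P| ≤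
      C * ∫ ω, |b ω - b' ω| ∂P + D * ∫ ω, |a ω - a' ω| ∂P := by
  have h1 := ((hb.sub hb').abs.const_mul C)
  have h2 := ((ha.sub ha').abs.const_mul D)
  rw [← integral_sub hab hab', ← integral_const_mul, ← integral_const_mul]
  refine (abs_integral_le_integral_abs).trans ?_
  refine (integral_mono (hab.sub hab').abs (h1.add h2) fun ω => ?_).trans_eq (integral_add h1 h2)
  have : a ω * b ω - a' ω * b' ω = a ω * (b ω - b' ω) + b' ω * (a ω - a' ω) := by ring
  simp only [Pi.sub_apply, Pi.add_apply, this]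
  refine (abs_add_le _ _).trans ?_
  rw [abs_mul, abs_mul]
  gcongr
  exacts [hC ω, hD ω]

lemma Measurable.integrable_comp_of_abs_le [IsFiniteMeasure P] {E : Type*} [MeasurableSpace E]
    {q : E → ℝ} {W : Ω → E} (hq : Measurable q) (hW : Measurable W)
    (hb : ∃ C : ℝ, ∀ x, |q x| ≤ C) : Integrable (fun ω => q (W ω)) P :=
  (hq.comp hW).integrable_of_abs_le (hb.imp fun _ hC _ => hC _)

variable [IsProbabilityMeasure P]

lemma abs_mul_integral_sub_mul_integral_le {a b a' b' : Ω → ℝ} {C D : ℝ} (hC : ∀ ω, |a ω| ≤ C)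
    (hD : ∀ ω, |b' ω| ≤ D) (ha : Integrable a P) (ha' : Integrable a' P)
    (hb : Integrable b P) (hb' : Integrable b' P) :
    |(∫ ω, a ω ∂P) * ∫ ω, b ω ∂P - (∫ ω, a' ω ∂P) * ∫ ω, b' ω ∂P| ≤
      C * ∫ ω, |b ω - b' ω| ∂P + D * ∫ ω, |a ω - a' ω| ∂P := by
  have hbd : ∀ {u : Ω → ℝ} {K : ℝ}, (∀ ω, |u ω| ≤ K) → |∫ ω, u ω ∂P| ≤ K := fun {u K} hu => by
    simpa using norm_integral_le_of_norm_le_const (μ := P) (f := u) (.of_forall hu)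
  have hd : ∀ {u v : Ω → ℝ}, Integrable u P → Integrable v P →
      |∫ ω, u ω ∂P - ∫ ω, v ω ∂P| ≤ ∫ ω, |u ω - v ω| ∂P := fun hu hv => by
    rw [← integral_sub hu hv]
    exact abs_integral_le_integral_abs
  have : (∫ ω, a ω ∂P) * ∫ ω, b ω ∂P - (∫ ω, a' ω ∂P) * ∫ ω, b' ω ∂P =
    (∫ ω, a ω ∂P) * (∫ ω, b ω ∂P - ∫ ω, b' ω ∂P) +
      (∫ ω, b' ω ∂P) * (∫ ω, a ω ∂P - ∫ ω, a' ω ∂P) := by ring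
  rw [this]
  refine (abs_add_le _ _).trans ?_
  rw [abs_mul, abs_mul]
  have hC0 := (abs_nonneg _).trans (hbd hC)
  have hD0 := (abs_nonneg _).trans (hbd hD)
  exact add_le_add (mul_le_mul (hbd hC) (hd hb hb') (abs_nonneg _) hC0)
    (mul_le_mul (hbd hD) (hd ha ha') (abs_nonneg _) hD0)

variable {ι κ : Type*} [Fintype ι] [Fintype κ]

/-- Under almost sure convergence of random vectors, the covariance of bounded non-decreasing
measurable functions of the limits is approximated by covariances of bounded non-decreasing
functions of the approximating vectors. -/
theorem exists_monotone_eventually_covariance_approx {U : Ω → ι → ℝ} {V : Ω → κ → ℝ}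
    {Us : ℕ → Ω → ι → ℝ} {Vs : ℕ → Ω → κ → ℝ} (hU : Measurable U) (hV : Measurable V)
    (hUs : ∀ n, Measurable (Us n)) (hVs : ∀ n, Measurable (Vs n))
    (hUlim : ∀ᵐ ω ∂P, Tendsto (fun n => Us n ω) atTop (𝓝 (U ω)))
    (hVlim : ∀ᵐ ω ∂P, Tendsto (fun n => Vs n ω) atTop (𝓝 (V ω)))
    {f : (ι → ℝ) → ℝ} {g : (κ → ℝ) → ℝ}
    (hf : Monotone f) (hfm : Measurable f) (hfb : ∃ C : ℝ, ∀ x, |f x| ≤ C)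
    (hg : Monotone g) (hgm : Measurable g) (hgb : ∃ C : ℝ, ∀ x, |g x| ≤ C)
    {ε : ℝ} (hε : 0 < ε) :
    ∃ (h : (ι → ℝ) → ℝ) (k : (κ → ℝ) → ℝ),
      Monotone h ∧ Measurable h ∧ (∃ C : ℝ, ∀ x, |h x| ≤ C) ∧
      Monotone k ∧ Measurable k ∧ (∃ C : ℝ, ∀ x, |k x| ≤ C) ∧
      ∃ n, |(∫ ω, f (U ω) * g (V ω) ∂P - (∫ ω, f (U ω) ∂P) * ∫ ω, g (V ω) ∂P) -
        (∫ ω, h (Us n ω) * k (Vs n ω) ∂P -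
          (∫ ω, h (Us n ω) ∂P) * ∫ ω, k (Vs n ω) ∂P)| ≤ ε := by
  have := Measure.isProbabilityMeasure_map (μ := P) hU.aemeasurable
  have := Measure.isProbabilityMeasure_map (μ := P) hV.aemeasurable
  obtain ⟨C, hC⟩ := id hfb
  have hC0 : 0 ≤ C := (abs_nonneg _).trans (hC 0)
  -- The order matters: the tolerance for `k` uses the bound `C` of `f`, and that for `h` uses the
  -- bound `D` of `k`, known only once `k` is chosen. Each weighted error is at most `ε / 8`, so the
  -- two comparisons below cost `ε / 4` each, leaving `ε / 2` for the limit in `n`.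
  obtain ⟨k, hkc, hkm, ⟨D, hD⟩, hgk⟩ := hg.monotoneApproximable (μ := P.map V) hgm hgb
    (ε / (8 * (C + 1))) (by positivity)
  have hD0 : 0 ≤ D := (abs_nonneg _).trans (hD 0)
  obtain ⟨h, hhc, hhm, ⟨C', hC'⟩, hfh⟩ := hf.monotoneApproximable (μ := P.map U) hfm hfb
    (ε / (8 * (D + 1))) (by positivity)
  rw [integral_map hV.aemeasurable
    (show Measurable fun x => |g x - k x| from
      (hgm.sub hkc.measurable).abs).aestronglyMeasurable] at hgk
  rw [integral_map hU.aemeasurable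
    (show Measurable fun x => |f x - h x| from
      (hfm.sub hhc.measurable).abs).aestronglyMeasurable] at hfh
  have hmul : ∀ {q : (ι → ℝ) → ℝ} {r : (κ → ℝ) → ℝ}, Measurable q → Measurable r →
      (∃ C : ℝ, ∀ x, |q x| ≤ C) → (∃ C : ℝ, ∀ x, |r x| ≤ C) →
      Integrable (fun ω => q (U ω) * r (V ω)) P := fun hq hr ⟨A, hA⟩ ⟨B, hB⟩ =>
    ((hq.comp hU).mul (hr.comp hV)).integrable_of_abs_le ⟨A * B, fun ω => by
      rw [Pi.mul_apply, abs_mul]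
      exact mul_le_mul (hA _) (hB _) (abs_nonneg _) ((abs_nonneg _).trans (hA 0))⟩
  have hfi := hfm.integrable_comp_of_abs_le (P := P) hU hfb
  have hgi := hgm.integrable_comp_of_abs_le (P := P) hV hgb
  have hhi := hhc.measurable.integrable_comp_of_abs_le (P := P) hU ⟨C', hC'⟩
  have hki := hkc.measurable.integrable_comp_of_abs_le (P := P) hV ⟨D, hD⟩
  have e1 := abs_integral_mul_sub_integral_mul_le (P := P) (fun ω => hC (U ω))
    (fun ω => hD (V ω)) (hmul hfm hgm hfb hgb)
    (hmul hhc.measurable hkc.measurable ⟨C', hC'⟩ ⟨D, hD⟩) hfi hhi hgi hki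
  have e2 := abs_mul_integral_sub_mul_integral_le (P := P) (fun ω => hC (U ω))
    (fun ω => hD (V ω)) hfi hhi hgi hki
  have hsum : C * ∫ ω, |g (V ω) - k (V ω)| ∂P + D * ∫ ω, |f (U ω) - h (U ω)| ∂P ≤ ε / 4 := by
    have aux : ∀ {A I : ℝ}, 0 ≤ A → I ≤ ε / (8 * (A + 1)) → A * I ≤ ε / 8 := fun {A I} hA hI => by
      refine (mul_le_mul_of_nonneg_left hI hA).trans ?_
      rw [mul_div_assoc', div_le_div_iff₀ (by positivity) (by norm_num)]
      nlinarith
    have := aux hC0 hgk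
    have := aux hD0 hfh
    linarith
  have t1 : Tendsto (fun n => ∫ ω, h (Us n ω) ∂P) atTop (𝓝 (∫ ω, h (U ω) ∂P)) :=
    tendsto_integral_of_dominated_convergence (fun _ => C')
      (fun n => (hhc.measurable.comp (hUs n)).aestronglyMeasurable) (integrable_const _)
      (fun n => .of_forall fun ω => hC' _)
      (hUlim.mono fun ω hω => (hhc.tendsto _).comp hω)
  have t2 : Tendsto (fun n => ∫ ω, k (Vs n ω) ∂P) atTop (𝓝 (∫ ω, k (V ω) ∂P)) :=
    tendsto_integral_of_dominated_convergence (fun _ => D)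
      (fun n => (hkc.measurable.comp (hVs n)).aestronglyMeasurable) (integrable_const _)
      (fun n => .of_forall fun ω => hD _)
      (hVlim.mono fun ω hω => (hkc.tendsto _).comp hω)
  have t3 : Tendsto (fun n => ∫ ω, h (Us n ω) * k (Vs n ω) ∂P) atTop
      (𝓝 (∫ ω, h (U ω) * k (V ω) ∂P)) :=
    tendsto_integral_of_dominated_convergence (fun _ => C' * D)
      (fun n => ((hhc.measurable.comp (hUs n)).mul
        (hkc.measurable.comp (hVs n))).aestronglyMeasurable) (integrable_const _)
      (fun n => .of_forall fun ω => by
        rw [Real.norm_eq_abs, abs_mul]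
        exact mul_le_mul (hC' _) (hD _) (abs_nonneg _) ((abs_nonneg _).trans (hC' 0)))
      ((hUlim.and hVlim).mono fun ω hω =>
        ((hhc.tendsto _).comp hω.1).mul ((hkc.tendsto _).comp hω.2))
  obtain ⟨n, hn⟩ := ((t3.sub (t1.mul t2)).eventually (Metric.ball_mem_nhds _ (half_pos hε))).exists
  refine ⟨h, k, hhm, hhc.measurable, ⟨C', hC'⟩, hkm, hkc.measurable, ⟨D, hD⟩, n, ?_⟩
  rw [Real.dist_eq] at hn
  have a1 := abs_le.1 (e1.trans hsum)
  have a2 := abs_le.1 (e2.trans hsum)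
  have a3 := abs_le.1 hn.le
  rw [abs_le]
  constructor <;> linarith [a1.1, a1.2, a2.1, a2.2, a3.1, a3.2]

variable {X : ι → Ω → ℝ} {Xs : ℕ → ι → Ω → ℝ}

/-- Negative association is preserved under almost sure convergence. -/
theorem NegativelyAssociated.of_tendsto (hX : ∀ i, Measurable (X i))
    (hXs : ∀ n i, Measurable (Xs n i))
    (hlim : ∀ᵐ ω ∂P, ∀ i, Tendsto (fun n => Xs n i ω) atTop (𝓝 (X i ω)))
    (H : ∀ n, NegativelyAssociated P (Xs n)) : NegativelyAssociated P X := by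
  classical
  intro J f g hf hfm hfb hg hgm hgb
  refine sub_nonpos.1 (le_of_forall_pos_le_add fun ε hε => ?_)
  obtain ⟨h, k, hh, hhm, hhb, hk, hkm, hkb, n, hn⟩ :=
    exists_monotone_eventually_covariance_approx (P := P)
      (U := fun ω (i : J) => X i ω) (V := fun ω (i : ↥(Jᶜ)) => X i ω)
      (Us := fun n ω (i : J) => Xs n i ω) (Vs := fun n ω (i : ↥(Jᶜ)) => Xs n i ω)
      (measurable_pi_lambda _ fun i => hX i) (measurable_pi_lambda _ fun i => hX i)
      (fun n => measurable_pi_lambda _ fun i => hXs n i)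
      (fun n => measurable_pi_lambda _ fun i => hXs n i)
      (hlim.mono fun ω hω => tendsto_pi_nhds.2 fun i => hω i)
      (hlim.mono fun ω hω => tendsto_pi_nhds.2 fun i => hω i) hf hfm hfb hg hgm hgb hε
  have := H n J h k hh hhm hhb hk hkm hkb
  linarith [(abs_le.1 hn).2]

/-- Positive association is preserved under almost sure convergence. -/
theorem PositivelyAssociated.of_tendsto (hX : ∀ i, Measurable (X i))
    (hXs : ∀ n i, Measurable (Xs n i))
    (hlim : ∀ᵐ ω ∂P, ∀ i, Tendsto (fun n => Xs n i ω) atTop (𝓝 (X i ω)))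
    (H : ∀ n, PositivelyAssociated P (Xs n)) : PositivelyAssociated P X := by
  classical
  intro J f g hf hfm hfb hg hgm hgb
  refine sub_nonneg.1 (le_of_forall_pos_le_add fun ε hε => ?_)
  obtain ⟨h, k, hh, hhm, hhb, hk, hkm, hkb, n, hn⟩ :=
    exists_monotone_eventually_covariance_approx (P := P)
      (U := fun ω (i : J) => X i ω) (V := fun ω (i : J) => X i ω)
      (Us := fun n ω (i : J) => Xs n i ω) (Vs := fun n ω (i : J) => Xs n i ω)
      (measurable_pi_lambda _ fun i => hX i) (measurable_pi_lambda _ fun i => hX i)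
      (fun n => measurable_pi_lambda _ fun i => hXs n i)
      (fun n => measurable_pi_lambda _ fun i => hXs n i)
      (hlim.mono fun ω hω => tendsto_pi_nhds.2 fun i => hω i)
      (hlim.mono fun ω hω => tendsto_pi_nhds.2 fun i => hω i) hf hfm hfb hg hgm hgb hε
  have := H n J h k hh hhm hhb hk hkm hkb
  linarith [(abs_le.1 hn).1]

end Limits

/-! ### Sums over disjoint blocks of coordinates. -/

section Blocks

variable {Ω ι κ : Type*} [MeasurableSpace Ω] {P : Measure Ω}

/-- Composing a bounded non-decreasing measurable function with sums over finite families of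
coordinates keeps it bounded, non-decreasing and measurable. -/
lemma monotone_measurable_bounded_comp_sum {K L : Type*} {F : L → Type*}
    [∀ i, Fintype (F i)] (φ : ∀ i, F i → K) {f : (L → ℝ) → ℝ} (hf : Monotone f)
    (hfm : Measurable f) (hfb : ∃ C : ℝ, ∀ x, |f x| ≤ C) :
    Monotone (fun x : K → ℝ => f fun i => ∑ k, x (φ i k)) ∧
      Measurable (fun x : K → ℝ => f fun i => ∑ k, x (φ i k)) ∧
      ∃ C : ℝ, ∀ x : K → ℝ, |f fun i => ∑ k, x (φ i k)| ≤ C :=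
  ⟨fun _ _ hxy => hf fun i => Finset.sum_le_sum fun k _ => hxy (φ i k),
    hfm.comp (measurable_pi_lambda _ fun i => Finset.measurable_sum _ fun k _ =>
      measurable_pi_apply (φ i k)), hfb.imp fun _ hC _ => hC _⟩

variable [Fintype κ] [DecidableEq ι] {X : κ → Ω → ℝ}

/-- Sums over disjoint blocks of a negatively associated family are negatively associated. -/
theorem NegativelyAssociated.sum_fiber (hX : NegativelyAssociated P X) (p : κ → ι) :
    NegativelyAssociated P fun i ω => ∑ k : {k // p k = i}, X k ω := by
  intro J f g hf hfm hfb hg hgm hgb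
  obtain ⟨h1, h2, h3⟩ := monotone_measurable_bounded_comp_sum
    (fun (i : J) (k : {k // p k = i}) => (⟨k, show p k ∈ J by rw [k.2]; exact i.2⟩ : ↥(p ⁻¹' J)))
    hf hfm hfb
  obtain ⟨h4, h5, h6⟩ := monotone_measurable_bounded_comp_sum
    (fun (i : ↥(Jᶜ)) (k : {k // p k = i}) =>
      (⟨k, show p k ∈ Jᶜ by rw [k.2]; exact i.2⟩ : ↥((p ⁻¹' J)ᶜ))) hg hgm hgb
  -- Blocks indexed by `J` and by `Jᶜ` use coordinates from complementary sets, as negative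
  -- association requires.
  exact hX (p ⁻¹' J) _ _ h1 h2 h3 h4 h5 h6

/-- Sums over disjoint blocks of a positively associated family are positively associated. -/
theorem PositivelyAssociated.sum_fiber (hX : PositivelyAssociated P X) (p : κ → ι) :
    PositivelyAssociated P fun i ω => ∑ k : {k // p k = i}, X k ω := by
  intro J f g hf hfm hfb hg hgm hgb
  obtain ⟨h1, h2, h3⟩ := monotone_measurable_bounded_comp_sum
    (fun (i : J) (k : {k // p k = i}) => (⟨k, show p k ∈ J by rw [k.2]; exact i.2⟩ : ↥(p ⁻¹' J)))
    hf hfm hfb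
  obtain ⟨h4, h5, h6⟩ := monotone_measurable_bounded_comp_sum
    (fun (i : J) (k : {k // p k = i}) => (⟨k, show p k ∈ J by rw [k.2]; exact i.2⟩ : ↥(p ⁻¹' J)))
    hg hgm hgb
  exact hX (p ⁻¹' J) _ _ h1 h2 h3 h4 h5 h6

end Blocks

/-! ### Partitions and approximations by sets of the semi-ring. -/

section RandomMeasure

variable {Ω S : Type*} [MeasurableSpace Ω] [MetricSpace S] [MeasurableSpace S]

lemma LocallyFiniteMeasure.measurable_apply {B : Set S} (hB : MeasurableSet B) :
    Measurable fun μ : LocallyFiniteMeasure S => μ.1 B :=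
  measurable_iff_comap_le.2 (le_iSup₂_of_le B hB le_rfl)

lemma measurable_evalVector {M : Ω → LocallyFiniteMeasure S} (hM : Measurable M) {n : ℕ}
    {B : Fin n → Set S} (hB : ∀ i, MeasurableSet (B i)) (i : Fin n) :
    Measurable (evalVector M B i) :=
  ((LocallyFiniteMeasure.measurable_apply (hB i)).comp hM).ennreal_toReal

lemma isSetRing_boundedBorelSets : IsSetRing (boundedBorelSets S) where
  empty_mem := ⟨Bornology.isBounded_empty, .empty⟩
  union_mem _ _ h₁ h₂ := ⟨h₁.1.union h₂.1, h₁.2.union h₂.2⟩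
  sdiff_mem _ _ h₁ h₂ := ⟨h₁.1.subset Set.sdiff_subset, h₁.2.diff h₂.2⟩

lemma IsDissectingSemiring.supClosure_subset {I : Set (Set S)} (hI : IsDissectingSemiring I) :
    supClosure I ⊆ boundedBorelSets S :=
  supClosure_min hI.subset_boundedBorelSets fun _ h₁ _ h₂ =>
    isSetRing_boundedBorelSets.union_mem h₁ h₂

/-- Disjoint sets of the ring generated by a semi-ring are partitioned simultaneously by a finite
disjoint family of the semi-ring. -/
lemma IsDissectingSemiring.exists_partition {I : Set (Set S)} (hI : IsDissectingSemiring I) {n : ℕ}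
    {A : Fin n → Set S} (hA : ∀ i, A i ∈ supClosure I)
    (hd : Pairwise fun i j => Disjoint (A i) (A j)) :
    ∃ (m : ℕ) (B : Fin m → Set S) (p : Fin m → Fin n), (∀ j, B j ∈ I) ∧
      (Pairwise fun i j => Disjoint (B i) (B j)) ∧
      ∀ (μ : LocallyFiniteMeasure S) (i : Fin n),
        (μ.1 (A i)).toReal = ∑ k : {k // p k = i}, (μ.1 (B k)).toReal := by
  classical
  choose Q hQ using fun i => hI.isSetSemiring.mem_supClosure_iff.1 (hA i)
  -- The partitions `Q i` are flattened into one family; the first component of the sigma type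
  -- records the block.
  let e := (Fintype.equivFin (Σ i, {s // s ∈ (Q i).parts})).symm
  refine ⟨_, fun j => (e j).2.1, fun j => (e j).1, fun j => hQ _ (e j).2.2, ?_, ?_⟩
  · intro j j' hjj'
    have hne := e.injective.ne hjj'
    beta_reduce
    revert hne
    generalize e j = x, e j' = y
    obtain ⟨i, s, hs⟩ := x
    obtain ⟨i', s', hs'⟩ := y
    intro hne
    by_cases hii : i = i'
    · subst hii
      exact (Q i).disjoint hs hs' fun h => hne (by subst h; rfl)
    · exact (hd hii).mono ((Q i).le hs) ((Q i').le hs')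
  · intro μ i
    have hsub : ∑ k : {k // (e k).1 = i}, (μ.1 (e k).2.1).toReal =
        ∑ s ∈ (Q i).parts, (μ.1 s).toReal := by
      rw [← Finset.sum_subtype (Finset.univ.filter fun k => (e k).1 = i) (by simp)
        fun k => (μ.1 (e k).2.1).toReal, Finset.sum_filter,
        e.sum_comp fun x => if x.1 = i then (μ.1 x.2.1).toReal else 0, Fintype.sum_sigma,
        Finset.sum_eq_single i (by intro j _ hj; simp [hj]) (by simp)]
      simp only [if_true]
      exact Finset.sum_coe_sort (Q i).parts fun s => (μ.1 s).toReal
    rw [hsub, ← ENNReal.toReal_sum fun s hs =>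
      (μ.2 s (hI.subset_boundedBorelSets (hQ i hs))).ne]
    congr 1
    have hU : A i = ⋃ s ∈ (Q i).parts, s := by
      conv_lhs => rw [← (Q i).sup_parts]
      simp
    conv_lhs => rw [hU]
    exact measure_biUnion_finset (f := id) (Q i).disjoint
      fun s hs => (hI.subset_boundedBorelSets (hQ i hs)).2

variable [BorelSpace S] {P : Measure Ω} [IsProbabilityMeasure P]
  {I : Set (Set S)} {M : Ω → LocallyFiniteMeasure S}

/-- Approximation of one bounded Borel set, almost surely in the random measure restricted
to `K`. -/
lemma IsDissectingSemiring.exists_seq_tendsto_symmDiff (hI : IsDissectingSemiring I)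
    (hM : Measurable M) {K B : Set S} (hK : K ∈ boundedBorelSets S) (hB : MeasurableSet B) :
    ∃ A : ℕ → Set S, (∀ k, A k ∈ supClosure I) ∧
      ∀ᵐ ω ∂P, Tendsto (fun k => (M ω).1 ((A k ∆ B) ∩ K)) atTop (𝓝 0) := by
  have hev : ∀ {s : Set S}, MeasurableSet s → Measurable fun ω => (M ω).1 s := fun hs =>
    (LocallyFiniteMeasure.measurable_apply hs).comp hM
  have hKm := hK.2
  -- The normalisation gives `κ ω` mass at most 1, so its mean `ν` is finite even if `M(K)` is not
  -- integrable. For each `ω` the factor is positive and finite, hence can be undone at the end.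
  let κ : Ω → Measure S := fun ω => (1 + (M ω).1 K)⁻¹ • (M ω).1.restrict K
  have hκs : ∀ {s : Set S}, MeasurableSet s → ∀ ω,
      κ ω s = (1 + (M ω).1 K)⁻¹ * (M ω).1 (s ∩ K) := fun hs ω => by
    simp [κ, Measure.restrict_apply hs]
  have hκ : Measurable κ := Measure.measurable_of_measurable_coe _ fun s hs => by
    simp_rw [hκs hs]
    exact ((hev hKm).const_add 1).inv.mul (hev (hs.inter hKm))
  let ν := P.bind κ
  have hν : ∀ {s : Set S}, MeasurableSet s → ν s = ∫⁻ ω, κ ω s ∂P := fun hs =>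
    Measure.bind_apply hs hκ.aemeasurable
  have : IsFiniteMeasure ν := ⟨by
    rw [hν .univ]
    refine (lintegral_mono (g := fun _ => 1) fun ω => ?_).trans_lt (by simp)
    rw [hκs .univ, Set.univ_inter, mul_comm, ← div_eq_mul_inv]
    exact ENNReal.div_le_of_le_mul (by rw [one_mul]; exact le_add_self)⟩
  have hcov : ∃ D : Set (Set S), D.Countable ∧ D ⊆ I ∧ ν (⋃₀ D)ᶜ = 0 := by
    obtain ⟨T, hT, hTc, hTU⟩ := hI.isOpen_eq_sUnion Set.univ isOpen_univ
    exact ⟨T, hTc, hT, by simp [← hTU]⟩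
  have hgen : ‹MeasurableSpace S› = MeasurableSpace.generateFrom I :=
    (BorelSpace.measurable_eq).trans hI.generateFrom_eq.symm
  -- The errors `2⁻¹ ^ k` are summable, so the sum of the `κ ω (A k ∆ B)` has finite mean. It is
  -- then almost surely finite, and its terms tend to 0.
  choose A hA hAB using fun k : ℕ => exists_measure_symmDiff_lt_of_generateFrom_isSetSemiring
    (μ := ν) hI.isSetSemiring hcov hgen hB (ε := (2⁻¹ : ENNReal) ^ k)
    (ENNReal.pow_pos (by simp) k)
  refine ⟨A, hA, ?_⟩
  have hm : ∀ k, MeasurableSet (A k ∆ B) := fun k => (hI.supClosure_subset (hA k)).2.symmDiff hB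
  have hmk : ∀ k, AEMeasurable (fun ω => κ ω (A k ∆ B)) P := fun k =>
    ((Measure.measurable_coe (hm k)).comp hκ).aemeasurable
  have hsum : ∫⁻ ω, ∑' k, κ ω (A k ∆ B) ∂P ≠ ⊤ := by
    rw [lintegral_tsum hmk]
    refine ne_top_of_le_ne_top (b := ∑' k : ℕ, (2⁻¹ : ENNReal) ^ k) ?_
      (ENNReal.tsum_le_tsum fun k => ?_)
    · rw [ENNReal.tsum_geometric]; simp
    · rw [← hν (hm k)]; exact (hAB k).le
  filter_upwards [ae_lt_top' (.tsum hmk) hsum] with ω hω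
  have h0 := ENNReal.tendsto_atTop_zero_of_tsum_ne_top hω.ne
  have htop : 1 + (M ω).1 K ≠ ⊤ := ENNReal.add_ne_top.2 ⟨ENNReal.one_ne_top, ((M ω).2 K hK).ne⟩
  have h1 := ENNReal.Tendsto.const_mul (a := 1 + (M ω).1 K) h0 (.inr htop)
  rw [mul_zero] at h1
  refine h1.congr fun k => ?_
  rw [hκs (hm k), ← mul_assoc, ENNReal.mul_inv_cancel (by simp) htop, one_mul]

/-- Disjoint bounded Borel sets are approximated, almost surely in the random measure, by disjoint
sets of the ring generated by the semi-ring. -/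
theorem IsDissectingSemiring.exists_tendsto_evalVector (hI : IsDissectingSemiring I)
    (hM : Measurable M) {n : ℕ} {B : Fin n → Set S} (hB : ∀ i, B i ∈ boundedBorelSets S)
    (hd : Pairwise fun i j => Disjoint (B i) (B j)) :
    ∃ A : ℕ → Fin n → Set S, (∀ k i, A k i ∈ supClosure I) ∧
      (∀ k, Pairwise fun i j => Disjoint (A k i) (A k j)) ∧
      ∀ᵐ ω ∂P, ∀ i, Tendsto (fun k => evalVector M (A k) i ω) atTop (𝓝 (evalVector M B i ω)) := by
  classical
  have hR := hI.isSetSemiring.isSetRing_supClosure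
  obtain ⟨T, hTI, hTf, hT⟩ := hI.exists_finite_cover (⋃ i, B i)
    ⟨Bornology.isBounded_iUnion.2 fun i => (hB i).1, .iUnion fun i => (hB i).2⟩
  set K := ⋃₀ T with hKdef
  have hBK : ∀ i, B i ⊆ K := fun i => (Set.subset_iUnion B i).trans hT
  have hKR : K ∈ supClosure I := by
    have := hR.biUnion_mem (s := id) hTf.toFinset fun s hs =>
      subset_supClosure (hTI (hTf.mem_toFinset.1 hs))
    simpa [hKdef, Set.sUnion_eq_biUnion] using this
  have hK := hI.supClosure_subset hKR
  choose A₀ hA₀ hlim using fun i =>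
    hI.exists_seq_tendsto_symmDiff (P := P) hM hK (hB i).2
  -- Removing all the other approximants forces disjointness; intersecting with the ring set `K`,
  -- which covers every `B i`, confines the error to `K`.
  let A : ℕ → Fin n → Set S := fun k i =>
    (A₀ i k \ ⋃ j ∈ Finset.univ.erase i, A₀ j k) ∩ K
  have hAR : ∀ k i, A k i ∈ supClosure I := fun k i =>
    hR.inter_mem (hR.sdiff_mem (hA₀ i k) (hR.biUnion_mem _ fun j _ => hA₀ j k)) hKR
  refine ⟨A, hAR, fun k i j hij => ?_, ?_⟩
  · refine Set.disjoint_left.2 fun x hx hx' => hx'.1.2 ?_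
    exact Set.mem_biUnion (Finset.mem_erase.2 ⟨hij, Finset.mem_univ i⟩) hx.1.1
  -- A point of `B i` removed because it lies in `A₀ j k` is outside `B j` by disjointness, so it is
  -- already an error of the `j`-th approximation.
  have hsub : ∀ k i, A k i ∆ B i ⊆ ⋃ j ∈ Finset.univ, (A₀ j k ∆ B j) ∩ K := by
    rintro k i x (⟨hxA, hxB⟩ | ⟨hxB, hxA⟩)
    · exact Set.mem_biUnion (Finset.mem_univ i) ⟨.inl ⟨hxA.1.1, hxB⟩, hxA.2⟩
    · have hxK := hBK i hxB
      by_cases hx : x ∈ A₀ i k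
      · have : x ∈ ⋃ j ∈ Finset.univ.erase i, A₀ j k := by
          by_contra h
          exact hxA ⟨⟨hx, h⟩, hxK⟩
        obtain ⟨j, hj, hxj⟩ := Set.mem_iUnion₂.1 this
        exact Set.mem_biUnion (Finset.mem_univ j) ⟨.inl ⟨hxj, fun hxB' =>
          Set.disjoint_left.1 (hd (Finset.ne_of_mem_erase hj)) hxB' hxB⟩, hxK⟩
      · exact Set.mem_biUnion (Finset.mem_univ i) ⟨.inr ⟨hxB, hx⟩, hxK⟩
  filter_upwards [ae_all_iff.2 hlim] with ω hω i
  have hs : Tendsto (fun k => ∑ j, (M ω).1 ((A₀ j k ∆ B j) ∩ K)) atTop (𝓝 0) := by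
    simpa using tendsto_finsetSum Finset.univ fun j _ => hω j
  have h0 : Tendsto (fun k => (M ω).1 (A k i ∆ B i)) atTop (𝓝 0) :=
    tendsto_of_tendsto_of_tendsto_of_le_of_le tendsto_const_nhds hs (fun _ => zero_le) fun k =>
      (measure_mono (hsub k i)).trans (measure_biUnion_finset_le _ _)
  have h1 := (ENNReal.tendsto_toReal ENNReal.zero_ne_top).comp h0
  refine tendsto_iff_dist_tendsto_zero.2 (squeeze_zero (fun _ => dist_nonneg) (fun k => ?_) h1)
  have hAk := hI.supClosure_subset (hAR k i)
  exact abs_measureReal_sub_le_measureReal_symmDiff' hAk.2.nullMeasurableSet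
    (hB i).2.nullMeasurableSet ((M ω).2 _ hAk).ne ((M ω).2 _ (hB i)).ne

end RandomMeasure

/-! ### The vector of length zero. -/

section Empty

variable {Ω ι : Type*} [MeasurableSpace Ω] {P : Measure Ω} [IsProbabilityMeasure P] [IsEmpty ι]

lemma NegativelyAssociated.of_isEmpty (X : ι → Ω → ℝ) : NegativelyAssociated P X := by
  intro J f g _ _ _ _ _ _
  simp [Subsingleton.elim (fun i : J => X i _) isEmptyElim,
    Subsingleton.elim (fun i : ↥(Jᶜ) => X i _) isEmptyElim]

lemma PositivelyAssociated.of_isEmpty (X : ι → Ω → ℝ) : PositivelyAssociated P X := by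
  intro J f g _ _ _ _ _ _
  simp [Subsingleton.elim (fun i : J => X i _) isEmptyElim]

end Empty

/-! ### The two equivalences. -/

theorem lemma4p5 {Ω S : Type*} [MeasurableSpace Ω] (P : Measure Ω) [IsProbabilityMeasure P]
    [MetricSpace S] [PolishSpace S] [MeasurableSpace S] [BorelSpace S]
    (I : Set (Set S)) (hI : IsDissectingSemiring I)
    (M : Ω → LocallyFiniteMeasure S) (hM : Measurable M) :
    ((∀ n : ℕ, 1 ≤ n → ∀ B : Fin n → Set S, (∀ i, B i ∈ I) →
          Pairwise (fun i j => Disjoint (B i) (B j)) →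
          NegativelyAssociated P (evalVector M B)) ↔
      (∀ n : ℕ, 1 ≤ n → ∀ B : Fin n → Set S, (∀ i, B i ∈ boundedBorelSets S) →
          Pairwise (fun i j => Disjoint (B i) (B j)) →
          NegativelyAssociated P (evalVector M B))) ∧
    ((∀ n : ℕ, 1 ≤ n → ∀ B : Fin n → Set S, (∀ i, B i ∈ I) →
          Pairwise (fun i j => Disjoint (B i) (B j)) →
          PositivelyAssociated P (evalVector M B)) ↔
      (∀ n : ℕ, 1 ≤ n → ∀ B : Fin n → Set S, (∀ i, B i ∈ boundedBorelSets S) →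
          Pairwise (fun i j => Disjoint (B i) (B j)) →
          PositivelyAssociated P (evalVector M B))) := by
  refine ⟨⟨fun H n _ B hB hd => ?_, fun H n hn B hB =>
      H n hn B fun i => hI.subset_boundedBorelSets (hB i)⟩,
    ⟨fun H n _ B hB hd => ?_, fun H n hn B hB =>
      H n hn B fun i => hI.subset_boundedBorelSets (hB i)⟩⟩
  · obtain ⟨A, hA, hAd, hlim⟩ := hI.exists_tendsto_evalVector (P := P) hM hB hd
    refine .of_tendsto (measurable_evalVector hM fun i => (hB i).2)
      (fun k => measurable_evalVector hM fun i => (hI.supClosure_subset (hA k i)).2) hlim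
      fun k => ?_
    obtain ⟨m, C, p, hC, hCd, hsum⟩ := hI.exists_partition (hA k) (hAd k)
    have hCa : NegativelyAssociated P (evalVector M C) := by
      -- A partition of the empty set has no parts, so `m = 0` occurs when every `A k i` is empty;
      -- `H` does not cover this case.
      rcases Nat.eq_zero_or_pos m with rfl | hm
      · exact .of_isEmpty _
      · exact H m hm C hC hCd
    convert hCa.sum_fiber p using 1
    ext i ω
    exact hsum (M ω) i
  · obtain ⟨A, hA, hAd, hlim⟩ := hI.exists_tendsto_evalVector (P := P) hM hB hd
    refine .of_tendsto (measurable_evalVector hM fun i => (hB i).2)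
      (fun k => measurable_evalVector hM fun i => (hI.supClosure_subset (hA k i)).2) hlim
      fun k => ?_
    obtain ⟨m, C, p, hC, hCd, hsum⟩ := hI.exists_partition (hA k) (hAd k)
    have hCa : PositivelyAssociated P (evalVector M C) := by
      rcases Nat.eq_zero_or_pos m with rfl | hm
      · exact .of_isEmpty _
      · exact H m hm C hC hCd
    convert hCa.sum_fiber p using 1
    ext i ω
    exact hsum (M ω) i
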